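/- A (two-party, multi-round) quantum communication protocol without prior entanglement works as follows. Alice receives $x\in X$, Bob receives $y\in Y$ (for example $X=Y=\{0,1\}^n$). They start in a product state $\rho_{A_0}\otimes\sigma_{B_0}$ of finite-dimensional local registers. Alice applies an isometry $A_0\to A_1M_1$ depending on $x$ and sends the message $M_1$ to Bob, keeping $A_1$; Bob applies an isometry $M_1B_0\to M_2B_1$ depending on $y$ and sends $M_2$ to Alice, keeping $B_1$; and so on in alternation. When the last message $M_{2r-1}$ ($r\ge 1$) has arrived at Bob, he measures it together with his memory $B_{r-1}$ by a two-outcome measurement depending on $y$, and outputs the outcome. Each message $M_k$ consists of a number $q_k\ge 0$ of qubits that does not depend on the inputs, and the protocol is a $Q$-qubit protocol if $\sum_{k=1}^{2r-1}q_k=Q$. (An isometry is a unitary acting on the register together with freshly prepared ancillas.) The protocol is memoryless if all the registers $A_i$ and $B_i$ are one-dimensional, that is, if neither party keeps any quantum memory while a message is on its way. Proposition (memoryless protocol). For every $Q$-qubit quantum communication protocol without prior entanglement there is a memoryless quantum communication protocol which communicates $Q^2+2Q$ qubits in total and which, for all inputs $x,y$, produces each output $z\in\{0,1\}$ with exactly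 the same probability as the original protocol. -/

import Mathlib

open scoped Matrix Kronecker ComplexOrder

namespace QComm

/-- Computational basis labels of a register of `q` qubits; the register has dimension `2 ^ q`. -/
abbrev Qubits (q : ℕ) : Type := Fin q → Fin 2

/-- A density matrix (mixed quantum state) of a register with basis labels `n`. -/
structure DensityMatrix (n : Type) [Fintype n] where
  mat : Matrix n n ℂ
  posSemidef : mat.PosSemidef
  trace_eq_one : mat.trace = 1

/-- A linear isometry from a register with basis labels `n` to a register with basis labels `m`.
When the two dimensions agree it is a unitary; in general it is a unitary applied to the register
together with freshly prepared ancillas. -/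
structure LocalIsometry (m n : Type) [Fintype m] [Fintype n] [DecidableEq n] where
  mat : Matrix m n ℂ
  isometry : matᴴ * mat = 1

/-- A two-outcome quantum measurement (POVM) on a register with basis labels `n`. -/
structure Measurement (n : Type) [Fintype n] [DecidableEq n] where
  effect : Bool → Matrix n n ℂ
  posSemidef : ∀ z, (effect z).PosSemidef
  sum_eq_one : effect false + effect true = 1

/-- Basis labels of the joint system: Alice's memory (dimension `a`), the message register
(`q` qubits), Bob's memory (dimension `b`). -/
abbrev Joint (a q b : ℕ) : Type := Fin a × Qubits q × Fin b

/-- An operation of Alice on her memory and the message, extended by the identity on Bob's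
memory. -/
def onAlice {a q a' q' : ℕ} (b : ℕ)
    (U : Matrix (Fin a' × Qubits q') (Fin a × Qubits q) ℂ) :
    Matrix (Joint a' q' b) (Joint a q b) ℂ :=
  (U ⊗ₖ (1 : Matrix (Fin b) (Fin b) ℂ)).submatrix
    (Equiv.prodAssoc (Fin a') (Qubits q') (Fin b)).symm
    (Equiv.prodAssoc (Fin a) (Qubits q) (Fin b)).symm

/-- An operation of Bob on the message and his memory, extended by the identity on Alice's
memory. -/
def onBob {q b q' b' : ℕ} (a : ℕ)
    (V : Matrix (Qubits q' × Fin b') (Qubits q × Fin b) ℂ) :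
    Matrix (Joint a q' b') (Joint a q b) ℂ :=
  (1 : Matrix (Fin a) (Fin a) ℂ) ⊗ₖ V

/-- What is left of a protocol at a moment when a message of `q` qubits has just arrived at Bob,
while Alice keeps a memory of dimension `a` and Bob keeps a memory of dimension `b`.
Inputs come from `X` (Alice) and `Y` (Bob).
* `measure`: Bob measures the message and his memory, and outputs the outcome.
* `round`: Bob applies an isometry depending on `y` and sends `q'` qubits to Alice, keeping a memory
  of dimension `b'`; then Alice applies an isometry depending on `x` and sends `q''` qubits to Bob,
  keeping a memory of dimension `a'`; then the protocol goes on with `rest`. -/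
inductive Continuation (X : Type*) (Y : Type*) : (a q b : ℕ) → Type _ where
  | measure {a q b : ℕ} (E : Y → Measurement (Qubits q × Fin b)) : Continuation X Y a q b
  | round {a q b q' b' a' q'' : ℕ}
      (V : Y → LocalIsometry (Qubits q' × Fin b') (Qubits q × Fin b))
      (U : X → LocalIsometry (Fin a' × Qubits q'') (Fin a × Qubits q'))
      (rest : Continuation X Y a' q'' b') : Continuation X Y a q b

namespace Continuation

variable {X : Type*} {Y : Type*}

/-- The number of qubits that are still to be communicated, in both directions together. -/
def cost {a q b : ℕ} : Continuation X Y a q b → ℕ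
  | measure _ => 0
  | round (q' := q') (q'' := q'') _ _ rest => q' + q'' + rest.cost

/-- From now on all memories that are kept while a message is on its way are trivial
(one-dimensional). -/
def Memoryless {a q b : ℕ} : Continuation X Y a q b → Prop
  | measure _ => True
  | round (b' := b') (a' := a') _ _ rest => b' = 1 ∧ a' = 1 ∧ rest.Memoryless

/-- The probability of the output `z` on the inputs `x`, `y` when the current joint state is `ρ`. -/
noncomputable def outputProb {a q b : ℕ} (x : X) (y : Y) (z : Bool) :
    Continuation X Y a q b → Matrix (Joint a q b) (Joint a q b) ℂ → ℝ
  | measure E, ρ => (onBob a ((E y).effect z) * ρ).trace.re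
  | round (b' := b') V U rest, ρ =>
      rest.outputProb x y z
        ((onAlice b' (U x).mat * onBob a (V y).mat) * ρ *
          (onAlice b' (U x).mat * onBob a (V y).mat)ᴴ)

end Continuation

/-- A multi-round two-party quantum communication protocol without prior entanglement, with inputs
from `X` and `Y` and an output bit. Alice and Bob start in a product state `ρA ⊗ ρB`, of local
dimensions `a₀` and `b₀`. Alice applies an isometry depending on `x`, sends `q₁` qubits to Bob and
keeps a memory of dimension `a₁`; then the parties proceed as in `rest`. Messages alternate, the
first one goes from Alice to Bob, and after the last one Bob measures. -/
structure Protocol (X : Type*) (Y : Type*) where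
  a₀ : ℕ
  b₀ : ℕ
  ρA : DensityMatrix (Fin a₀)
  ρB : DensityMatrix (Fin b₀)
  q₁ : ℕ
  a₁ : ℕ
  U₁ : X → LocalIsometry (Fin a₁ × Qubits q₁) (Fin a₀)
  rest : Continuation X Y a₁ q₁ b₀

namespace Protocol

variable {X : Type*} {Y : Type*}

/-- The total number of qubits communicated. -/
def cost (P : Protocol X Y) : ℕ := P.q₁ + P.rest.cost

/-- No party has any quantum memory besides the message: all memory registers, the initial ones
included, are one-dimensional. -/
def Memoryless (P : Protocol X Y) : Prop :=
  P.a₀ = 1 ∧ P.b₀ = 1 ∧ P.a₁ = 1 ∧ P.rest.Memoryless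

/-- The joint state after Alice's first operation on input `x`. -/
noncomputable def firstState (P : Protocol X Y) (x : X) :
    Matrix (Joint P.a₁ P.q₁ P.b₀) (Joint P.a₁ P.q₁ P.b₀) ℂ :=
  (((P.U₁ x).mat * P.ρA.mat * (P.U₁ x).matᴴ) ⊗ₖ P.ρB.mat).submatrix
    (Equiv.prodAssoc (Fin P.a₁) (Qubits P.q₁) (Fin P.b₀)).symm
    (Equiv.prodAssoc (Fin P.a₁) (Qubits P.q₁) (Fin P.b₀)).symm

/-- The probability that the protocol outputs the bit `z` on the inputs `x`, `y`. -/
noncomputable def outputProb (P : Protocol X Y) (x : X) (y : Y) (z : Bool) : ℝ :=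
  P.rest.outputProb x y z (P.firstState x)

end Protocol

end QComm

namespace QComm

open Matrix

/-! One message register carries the joint state of both parties back and forth. After `s`
communicated qubits of the original protocol, each party's share can be compressed to dimension at
most `2 ^ s`, so the joint state fits into `2 * s` qubits and whoever acts next can be given all of
it.

The compression is `exists_compression`. If a party's true memory is the image of a small register
under Kraus operators, then its next isometry followed by sending `q` qubits equals a small
isometry, whose kept register is at most `2 ^ q` times larger, followed by new Kraus operators on
that register. Only the small isometry is performed. The Kraus operators are postponed: in the end
Bob's are absorbed into his measurement, and Alice's sum to the identity and disappear.

`Simulable` is the invariant, proved by induction on the continuation with `Simulable.sendBob`,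
`Simulable.sendAlice` and `simulable_measure`. With `k` qubits still to be sent, the worst case is
one qubit per message: transfers at `s, s + 1, ..., s + k` cost `(k + 1) * (2 * s + k)` in total. At
the start `s = 0`, since mixed initial states are Kraus images of one-dimensional registers. Unused
budget pads the last message. -/

/-! ### Isometries: extension and compression. -/

/-- A matrix with orthonormal columns is part of a unitary matrix. -/
theorem exists_unitary_submatrix_eq {m n : Type*} [Fintype m] [DecidableEq m] [Fintype n]
    [DecidableEq n] (J : Matrix m n ℂ) (hJ : Jᴴ * J = 1) (ι : n ↪ m) :
    ∃ B : Matrix m m ℂ, Bᴴ * B = 1 ∧ B.submatrix id ι = J := by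
  classical
  let w : n → EuclideanSpace ℂ m := fun j => WithLp.toLp 2 (fun i => J i j)
  have hw : Orthonormal ℂ w := by
    rw [orthonormal_iff_ite]
    intro i j
    have h := congrFun (congrFun hJ i) j
    simp only [Matrix.mul_apply, Matrix.conjTranspose_apply, Matrix.one_apply] at h
    rw [← h]
    simp only [w, PiLp.inner_apply, RCLike.inner_apply]
    exact Finset.sum_congr rfl fun k _ => mul_comm _ _
  -- The value `0` off the range of `ι` is irrelevant: the basis extension only uses `v` on that
  -- range.
  let v : m → EuclideanSpace ℂ m := fun i => if h : ∃ j, ι j = i then w h.choose else 0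
  have hv : ∀ j, v (ι j) = w j := by
    intro j
    have h : ∃ j', ι j' = ι j := ⟨j, rfl⟩
    simp only [v, dif_pos h]
    rw [ι.injective h.choose_spec]
  have hvo : Orthonormal ℂ ((Set.range ι).domRestrict v) := by
    rw [orthonormal_iff_ite] at hw ⊢
    rintro ⟨i', hi⟩ ⟨j', hj⟩
    obtain ⟨i, rfl⟩ := Set.mem_range.1 hi
    obtain ⟨j, rfl⟩ := Set.mem_range.1 hj
    have h := hw i j
    rw [← hv i, ← hv j] at h
    exact h.trans (by simp only [Subtype.mk.injEq, ι.injective.eq_iff])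
  obtain ⟨b, hb⟩ := hvo.exists_orthonormalBasis_extension_of_card_eq (by simp)
  refine ⟨Matrix.of fun i j => b j i, ?_, ?_⟩
  · ext i j
    have h := orthonormal_iff_ite.1 b.orthonormal i j
    rw [Matrix.one_apply, ← h]
    simp only [Matrix.mul_apply, Matrix.conjTranspose_apply, Matrix.of_apply, PiLp.inner_apply,
      RCLike.inner_apply]
    exact Finset.sum_congr rfl fun k _ => mul_comm _ _
  · ext i j
    simp [hb (ι j) ⟨j, rfl⟩, hv, w]

theorem card_le_of_isometry {m n : Type*} [Fintype m] [Fintype n] [DecidableEq n]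
    (J : Matrix m n ℂ) (hJ : Jᴴ * J = 1) : Fintype.card n ≤ Fintype.card m := by
  have h := Matrix.rank_mul_le_right Jᴴ J
  rw [hJ, Matrix.rank_one] at h
  exact h.trans (Matrix.rank_le_card_height J)

theorem conjTranspose_submatrix_mul_submatrix {m n k : Type*} [Fintype m] [DecidableEq n]
    [DecidableEq k] {B : Matrix m n ℂ} (hB : Bᴴ * B = 1) (κ : k ↪ n) :
    (B.submatrix id κ)ᴴ * B.submatrix id κ = 1 := by
  ext i j
  have h := congrFun (congrFun hB (κ i)) (κ j)
  simpa [Matrix.mul_apply, Matrix.one_apply, κ.injective.eq_iff] using h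

/-- An isometry defined on the range of an isometry `J` extends to the whole space, provided that
the target is large enough. -/
theorem exists_isometry_mul_eq {m n k : Type*} [Fintype m] [DecidableEq m] [Fintype n]
    [DecidableEq n] [Fintype k] [DecidableEq k] (J : Matrix n k ℂ) (hJ : Jᴴ * J = 1)
    (U : Matrix m k ℂ) (hU : Uᴴ * U = 1) (h : Fintype.card n ≤ Fintype.card m) :
    ∃ A : Matrix m n ℂ, Aᴴ * A = 1 ∧ A * J = U := by
  obtain ⟨ι⟩ := Function.Embedding.nonempty_of_card_le (card_le_of_isometry J hJ)
  obtain ⟨κ⟩ := Function.Embedding.nonempty_of_card_le h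
  obtain ⟨B, hB, rfl⟩ := exists_unitary_submatrix_eq J hJ ι
  obtain ⟨C, hC, rfl⟩ := exists_unitary_submatrix_eq U hU (ι.trans κ)
  have hB' : B * Bᴴ = 1 := mul_eq_one_comm.1 hB
  -- `Bᴴ` turns the columns of `J` into the basis vectors labelled by `ι`; `κ` and then `C` carry
  -- these to the columns of `U`.
  refine ⟨C.submatrix id κ * Bᴴ, ?_, ?_⟩
  · rw [conjTranspose_mul, conjTranspose_conjTranspose, Matrix.mul_assoc,
      ← Matrix.mul_assoc _ _ Bᴴ, conjTranspose_submatrix_mul_submatrix hC, Matrix.one_mul, hB']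
  · have : Bᴴ * B.submatrix id ι = (1 : Matrix n n ℂ).submatrix id ι := by
      rw [← hB]; rfl
    rw [Matrix.mul_assoc, this]
    ext i j
    simp [Matrix.mul_apply, Matrix.one_apply]

theorem exists_isometry {m n : Type*} [Fintype m] [DecidableEq m] [Fintype n]
    [DecidableEq n] (h : Fintype.card n ≤ Fintype.card m) :
    ∃ J : Matrix m n ℂ, Jᴴ * J = 1 := by
  obtain ⟨κ⟩ := Function.Embedding.nonempty_of_card_le h
  exact ⟨_, conjTranspose_submatrix_mul_submatrix
    (B := (1 : Matrix m m ℂ)) (by simp) κ⟩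

/-- The columns of a matrix lie in a space whose dimension is the smaller one of the two sizes. -/
theorem exists_isometry_range {m n : Type*} [Fintype m] [DecidableEq m] [Fintype n]
    [DecidableEq n] (M : Matrix m n ℂ) :
    ∃ W : Matrix m (Fin (min (Fintype.card m) (Fintype.card n))) ℂ,
      Wᴴ * W = 1 ∧ W * (Wᴴ * M) = M := by
  classical
  let v : n → EuclideanSpace ℂ m := fun j => WithLp.toLp 2 (fun i => M i j)
  let S := Submodule.span ℂ (Set.range v)
  let b := stdOrthonormalBasis ℂ S
  let W₀ : Matrix m (Fin (Module.finrank ℂ S)) ℂ := Matrix.of fun i j => (b j : EuclideanSpace ℂ m) i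
  have hW₀ : W₀ᴴ * W₀ = 1 := by
    ext i j
    have h := orthonormal_iff_ite.1 b.orthonormal i j
    rw [Matrix.one_apply, ← h]
    simp only [W₀, Matrix.mul_apply, Matrix.conjTranspose_apply, Matrix.of_apply,
      Submodule.coe_inner, PiLp.inner_apply, RCLike.inner_apply]
    exact Finset.sum_congr rfl fun k _ => mul_comm _ _
  obtain ⟨C, hC⟩ : ∃ C : Matrix (Fin (Module.finrank ℂ S)) n ℂ, W₀ * C = M := by
    refine ⟨Matrix.of fun k j => b.repr ⟨v j, Submodule.subset_span ⟨j, rfl⟩⟩ k, ?_⟩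
    ext i j
    have h := congrArg (fun u : S => (u : EuclideanSpace ℂ m) i)
      (b.sum_repr ⟨v j, Submodule.subset_span ⟨j, rfl⟩⟩)
    simp only [Submodule.coe_sum, Submodule.coe_smul, WithLp.ofLp_sum, Finset.sum_apply,
      WithLp.ofLp_smul, Pi.smul_apply, smul_eq_mul] at h
    simp only [Matrix.mul_apply, W₀, Matrix.of_apply]
    rw [show M i j = v j i from rfl, ← h]
    exact Finset.sum_congr rfl fun k _ => mul_comm _ _
  have hr : Module.finrank ℂ S ≤ min (Fintype.card m) (Fintype.card n) :=
    le_min (by simpa using Submodule.finrank_le S) (finrank_range_le_card v)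
  -- The rank depends on `M`, hence later on the input; padding to the bound `min` makes the
  -- register size input-independent.
  obtain ⟨κ⟩ := Function.Embedding.nonempty_of_card_le
    (α := Fin (min (Fintype.card m) (Fintype.card n))) (β := m) (by simp)
  obtain ⟨B, hB, hBW⟩ := exists_unitary_submatrix_eq W₀ hW₀ ((Fin.castLEEmb hr).trans κ)
  have hW := conjTranspose_submatrix_mul_submatrix hB κ
  refine ⟨B.submatrix id κ, hW, ?_⟩
  have h : W₀ = B.submatrix id κ *
      (1 : Matrix (Fin (min (Fintype.card m) (Fintype.card n)))
        (Fin (min (Fintype.card m) (Fintype.card n))) ℂ).submatrix id (Fin.castLEEmb hr) := by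
    rw [← hBW]
    ext i j
    simp [Matrix.mul_apply, Matrix.one_apply]
  rw [← hC, h, Matrix.mul_assoc (B.submatrix id κ), ← Matrix.mul_assoc _ (B.submatrix id κ), hW,
    Matrix.one_mul]

/-- Compression: a family of operators into a bipartite register, normalized like Kraus operators,
factors through a single isometry whose second register has bounded dimension. -/
theorem exists_compression {κ b β ε : Type*} [Fintype κ] [DecidableEq κ] [Fintype b]
    [DecidableEq b] [Fintype β] [DecidableEq β] [Fintype ε] [DecidableEq ε]
    (A : ε → Matrix (κ × b) β ℂ) (hA : ∑ e, (A e)ᴴ * A e = 1) :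
    ∃ (V : Matrix (κ × Fin (min (Fintype.card (b × ε)) (Fintype.card (κ × β)))) β ℂ)
      (W : ε → Matrix b (Fin (min (Fintype.card (b × ε)) (Fintype.card (κ × β)))) ℂ),
      Vᴴ * V = 1 ∧ ∑ e, (W e)ᴴ * W e = 1 ∧ ∀ e, A e = ((1 : Matrix κ κ ℂ) ⊗ₖ W e) * V := by
  -- Regrouping the indices so that `b × ε` faces `κ × β`, as in the Schmidt decomposition: the rank
  -- is then at most the size of `κ × β`, however large `b` and `ε` are.
  let M : Matrix (b × ε) (κ × β) ℂ := Matrix.of fun i j => A i.2 (j.1, i.1) j.2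
  obtain ⟨W, hW, hWM⟩ := exists_isometry_range M
  let V : Matrix (κ × Fin (min (Fintype.card (b × ε)) (Fintype.card (κ × β)))) β ℂ :=
    Matrix.of fun i j => (Wᴴ * M) i.2 (i.1, j)
  let W' : ε → Matrix b (Fin (min (Fintype.card (b × ε)) (Fintype.card (κ × β)))) ℂ :=
    fun e => W.submatrix (fun i => (i, e)) id
  have hW' : ∑ e, (W' e)ᴴ * W' e = 1 := by
    rw [← hW]
    ext i j
    simp only [W', Matrix.sum_apply, Matrix.mul_apply, Fintype.sum_prod_type,
      Matrix.conjTranspose_apply, Matrix.submatrix_apply, id]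
    exact Finset.sum_comm
  have hAV : ∀ e, A e = ((1 : Matrix κ κ ℂ) ⊗ₖ W' e) * V := by
    intro e
    ext ⟨k, i⟩ j
    have h := congrFun (congrFun hWM (i, e)) (k, j)
    rw [Matrix.mul_apply] at h
    simp only [Matrix.mul_apply (M := _ ⊗ₖ _), Fintype.sum_prod_type, kroneckerMap_apply,
      Matrix.one_apply, ite_mul, one_mul, zero_mul, Finset.sum_ite_irrel, Finset.sum_const_zero,
      Finset.sum_ite_eq, Finset.mem_univ, if_true, V, W', Matrix.of_apply, Matrix.submatrix_apply,
      id]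
    exact h.symm
  refine ⟨V, W', ?_, hW', hAV⟩
  calc Vᴴ * V = Vᴴ * ((1 : Matrix κ κ ℂ) ⊗ₖ (∑ e, (W' e)ᴴ * W' e)) * V := by
        rw [hW', one_kronecker_one, Matrix.mul_one]
    _ = ∑ e, (A e)ᴴ * A e := by
        have : (1 : Matrix κ κ ℂ) ⊗ₖ (∑ e, (W' e)ᴴ * W' e) =
            ∑ e, ((1 : Matrix κ κ ℂ) ⊗ₖ W' e)ᴴ * ((1 : Matrix κ κ ℂ) ⊗ₖ W' e) := by
          simp only [conjTranspose_kronecker, ← mul_kronecker_mul, conjTranspose_one, Matrix.one_mul]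
          ext i j
          simp [Matrix.sum_apply, Finset.mul_sum]
        rw [this, Matrix.mul_sum, Matrix.sum_mul]
        refine Finset.sum_congr rfl fun e _ => ?_
        rw [hAV e, conjTranspose_mul]
        simp only [Matrix.mul_assoc]
    _ = 1 := hA

/-! ### Conjugation by operators, and local operations without memory. -/

/-- The operator `A` applied to a state. -/
def sandwich {m n : Type*} [Fintype n] (A : Matrix m n ℂ) (ρ : Matrix n n ℂ) : Matrix m m ℂ :=
  A * ρ * Aᴴ

theorem sandwich_sandwich {m n k : Type*} [Fintype n] [Fintype k] (A : Matrix m n ℂ)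
    (B : Matrix n k ℂ) (ρ : Matrix k k ℂ) :
    sandwich A (sandwich B ρ) = sandwich (A * B) ρ := by
  simp only [sandwich, conjTranspose_mul, Matrix.mul_assoc]

theorem sandwich_sum {m n ι : Type*} [Fintype n] (A : Matrix m n ℂ) (s : Finset ι)
    (ρ : ι → Matrix n n ℂ) : sandwich A (∑ i ∈ s, ρ i) = ∑ i ∈ s, sandwich A (ρ i) := by
  simp only [sandwich, Matrix.mul_sum, Matrix.sum_mul]

theorem trace_mul_sandwich {m n : Type*} [Fintype m] [Fintype n] (E : Matrix m m ℂ)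
    (A : Matrix m n ℂ) (ρ : Matrix n n ℂ) :
    (E * sandwich A ρ).trace = (Aᴴ * E * A * ρ).trace := by
  rw [sandwich, ← Matrix.mul_assoc, Matrix.trace_mul_comm]
  simp only [Matrix.mul_assoc]

theorem isometry_mul {m n k : Type*} [Fintype m] [Fintype n] [DecidableEq n]
    [DecidableEq k] {A : Matrix m n ℂ} {B : Matrix n k ℂ} (hA : Aᴴ * A = 1) (hB : Bᴴ * B = 1) :
    (A * B)ᴴ * (A * B) = 1 := by
  rw [conjTranspose_mul, Matrix.mul_assoc, ← Matrix.mul_assoc _ A, hA, Matrix.one_mul, hB]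

theorem isometry_submatrix {m n m' n' : Type*} [Fintype m] [DecidableEq n] [Fintype m']
    [DecidableEq n'] {A : Matrix m n ℂ} (hA : Aᴴ * A = 1) (e : m' ≃ m) (e' : n' ≃ n) :
    (A.submatrix e e')ᴴ * A.submatrix e e' = 1 := by
  rw [conjTranspose_submatrix, submatrix_mul_equiv, hA, submatrix_one_equiv]

theorem isometry_kronecker {m n m' n' : Type*} [Fintype m] [DecidableEq n] [Fintype m']
    [DecidableEq n'] {A : Matrix m n ℂ} {B : Matrix m' n' ℂ} (hA : Aᴴ * A = 1) (hB : Bᴴ * B = 1) :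
    (A ⊗ₖ B)ᴴ * (A ⊗ₖ B) = 1 := by
  rw [conjTranspose_kronecker, ← mul_kronecker_mul, hA, hB, one_kronecker_one]

theorem sum_kronecker_sum {m n m' n' ι κ : Type*} (s : Finset ι) (t : Finset κ)
    (A : ι → Matrix m n ℂ) (B : κ → Matrix m' n' ℂ) :
    (∑ i ∈ s, A i) ⊗ₖ (∑ j ∈ t, B j) = ∑ i ∈ s, ∑ j ∈ t, A i ⊗ₖ B j := by
  ext
  simp [Matrix.sum_apply, Finset.sum_mul_sum]

/-- Every isometry of a message register without memories is an operation of Bob. -/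
theorem exists_onBob_eq {N N' : ℕ} (A : Matrix (Joint 1 N' 1) (Joint 1 N 1) ℂ) (hA : Aᴴ * A = 1) :
    ∃ V : LocalIsometry (Qubits N' × Fin 1) (Qubits N × Fin 1), onBob 1 V.mat = A := by
  refine ⟨⟨A.submatrix (Equiv.uniqueProd (Qubits N' × Fin 1) (Fin 1)).symm
    (Equiv.uniqueProd (Qubits N × Fin 1) (Fin 1)).symm, isometry_submatrix hA _ _⟩, ?_⟩
  ext ⟨i, i'⟩ ⟨j, j'⟩
  obtain rfl := Subsingleton.elim i j
  simp [onBob, Subsingleton.elim i 0]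

/-- Every isometry of a message register without memories is an operation of Alice. -/
theorem exists_onAlice_eq {N N' : ℕ} (A : Matrix (Joint 1 N' 1) (Joint 1 N 1) ℂ)
    (hA : Aᴴ * A = 1) :
    ∃ U : LocalIsometry (Fin 1 × Qubits N') (Fin 1 × Qubits N), onAlice 1 U.mat = A := by
  refine ⟨⟨A.submatrix
    ((Equiv.prodUnique (Fin 1 × Qubits N') (Fin 1)).symm.trans (Equiv.prodAssoc _ _ _))
    ((Equiv.prodUnique (Fin 1 × Qubits N) (Fin 1)).symm.trans (Equiv.prodAssoc _ _ _)),
    isometry_submatrix hA _ _⟩, ?_⟩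
  ext ⟨i, i', i''⟩ ⟨j, j', j''⟩
  obtain rfl := Subsingleton.elim i'' j''
  simp [onAlice, Subsingleton.elim i'' 0]

/-! ### Measurements. -/

namespace Measurement

variable {n m : Type} [Fintype n] [DecidableEq n] [Fintype m] [DecidableEq m]

/-- Measuring after an operation with Kraus operators `W`. -/
def comp {ε : Type} [Fintype ε] (E : Measurement m) (W : ε → Matrix m n ℂ)
    (hW : ∑ e, (W e)ᴴ * W e = 1) : Measurement n where
  effect z := ∑ e, (W e)ᴴ * E.effect z * W e
  posSemidef z := posSemidef_sum _ fun e _ => (E.posSemidef z).conjTranspose_mul_mul_same (W e)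
  sum_eq_one := by
    rw [← Finset.sum_add_distrib, ← hW]
    refine Finset.sum_congr rfl fun e _ => ?_
    rw [← Matrix.add_mul, ← Matrix.mul_add, E.sum_eq_one, Matrix.mul_one]

/-- Measuring one part of a bipartite register. -/
def tensorLeft (α : Type) [Fintype α] [DecidableEq α] (E : Measurement n) :
    Measurement (α × n) where
  effect z := (1 : Matrix α α ℂ) ⊗ₖ E.effect z
  posSemidef z := PosSemidef.one.kronecker (E.posSemidef z)
  sum_eq_one := by rw [← kronecker_add, E.sum_eq_one, one_kronecker_one]

/-- Measuring the preimage under an isometry; outcome `false` off its range. -/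
def pushforward (E : Measurement n) (J : Matrix m n ℂ) (hJ : Jᴴ * J = 1) : Measurement m where
  effect z := J * E.effect z * Jᴴ + if z then 0 else 1 - J * Jᴴ
  posSemidef z := by
    refine ((E.posSemidef z).mul_mul_conjTranspose_same J).add ?_
    cases z
    · have h : (1 - J * Jᴴ) = (1 - J * Jᴴ)ᴴ * (1 - J * Jᴴ) := by
        have h' : J * Jᴴ * (J * Jᴴ) = J * Jᴴ := by
          rw [Matrix.mul_assoc, ← Matrix.mul_assoc Jᴴ, hJ, Matrix.one_mul]
        simp only [conjTranspose_sub, conjTranspose_one, conjTranspose_mul,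
          conjTranspose_conjTranspose, Matrix.mul_sub, Matrix.sub_mul, Matrix.one_mul,
          Matrix.mul_one, h', sub_self, sub_zero]
      simp only [Bool.false_eq_true, if_false]
      rw [h]
      exact posSemidef_conjTranspose_mul_self _
    · simpa using PosSemidef.zero
  sum_eq_one := by
    have h : J * E.effect false * Jᴴ + J * E.effect true * Jᴴ = J * Jᴴ := by
      rw [← Matrix.add_mul, ← Matrix.mul_add, E.sum_eq_one, Matrix.mul_one]
    simp only [Bool.false_eq_true, if_false, if_true, add_zero]
    rw [add_right_comm, h, add_sub_cancel]

theorem pushforward_effect (E : Measurement n) (J : Matrix m n ℂ) (hJ : Jᴴ * J = 1) (z : Bool) :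
    Jᴴ * (E.pushforward J hJ).effect z * J = E.effect z := by
  have h : Jᴴ * (1 - J * Jᴴ) * J = 0 := by
    rw [Matrix.mul_sub, ← Matrix.mul_assoc, hJ]; simp
  have h' : Jᴴ * (J * E.effect z * Jᴴ) * J = E.effect z := by
    simp only [Matrix.mul_assoc, hJ, Matrix.mul_one]
    rw [← Matrix.mul_assoc, hJ, Matrix.one_mul]
  simp only [pushforward, Matrix.mul_add, Matrix.add_mul, h']
  cases z <;> simp [h]

end Measurement

/-- Every measurement of a message register without memories is a measurement by Bob. -/
theorem exists_onBob_effect_eq {N : ℕ} (E : Measurement (Joint 1 N 1)) :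
    ∃ E' : Measurement (Qubits N × Fin 1), ∀ z, onBob 1 (E'.effect z) = E.effect z := by
  let e := (Equiv.uniqueProd (Qubits N × Fin 1) (Fin 1)).symm
  refine ⟨⟨fun z => (E.effect z).submatrix e e, fun z => (E.posSemidef z).submatrix e, ?_⟩, ?_⟩
  · rw [show (E.effect false).submatrix e e + (E.effect true).submatrix e e =
      (E.effect false + E.effect true).submatrix e e from rfl, E.sum_eq_one, submatrix_one_equiv]
  · intro z
    ext ⟨i, i'⟩ ⟨j, j'⟩
    obtain rfl := Subsingleton.elim i j
    simp [onBob, e, Subsingleton.elim i 0]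

/-! ### Memoryless simulation, and handing over the joint state. -/

section Simulation

variable {X Y : Type*}

/-- The output probabilities `f` on states of a register held by Alice are realized by a memoryless
protocol that communicates `T` qubits, the first message having at least `2 * s` qubits. -/
def AliceSim {n : Type} [Fintype n] [DecidableEq n] (f : X → Y → Bool → Matrix n n ℂ → ℝ)
    (s T : ℕ) : Prop :=
  ∃ (M : ℕ) (U : X → Matrix (Joint 1 M 1) n ℂ) (c : Continuation X Y 1 M 1),
    -- Without memory an operation is an isometry between message registers, so messages cannot
    -- shrink. The bound lets a preceding message of `2 * s` qubits be followed by this one.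
    2 * s ≤ M ∧ (∀ x, (U x)ᴴ * U x = 1) ∧ c.Memoryless ∧ M + c.cost = T ∧
      ∀ x y z ρ, f x y z ρ = c.outputProb x y z (sandwich (U x) ρ)

/-- The output probabilities `f` on states of a register held by Bob are realized by a measurement,
or by a memoryless protocol that communicates `T` qubits, the first message having at least `2 * s`
qubits. -/
def BobSim {n : Type} [Fintype n] [DecidableEq n] (f : X → Y → Bool → Matrix n n ℂ → ℝ)
    (s T : ℕ) : Prop :=
  (∃ E : Y → Measurement n, ∀ x y z ρ, f x y z ρ = ((E y).effect z * ρ).trace.re) ∨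
  ∃ (N T' : ℕ) (V : Y → Matrix (Joint 1 N 1) n ℂ)
    (g : X → Y → Bool → Matrix (Joint 1 N 1) (Joint 1 N 1) ℂ → ℝ),
    2 * s ≤ N ∧ (∀ y, (V y)ᴴ * V y = 1) ∧ N + T' = T ∧ AliceSim g 0 T' ∧
      ∀ x y z ρ, f x y z ρ = g x y z (sandwich (V y) ρ)

variable {n m : Type} [Fintype n] [DecidableEq n] [Fintype m] [DecidableEq m]

theorem AliceSim.mono {f : X → Y → Bool → Matrix n n ℂ → ℝ} {s s' T : ℕ} (h : AliceSim f s T)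
    (hs : s' ≤ s) : AliceSim f s' T := by
  obtain ⟨M, U, c, hM, h⟩ := h
  exact ⟨M, U, c, by omega, h⟩

theorem BobSim.mono {f : X → Y → Bool → Matrix n n ℂ → ℝ} {s s' T : ℕ} (h : BobSim f s T)
    (hs : s' ≤ s) : BobSim f s' T := by
  obtain h | ⟨N, T', V, g, hN, h⟩ := h
  · exact Or.inl h
  · exact Or.inr ⟨N, T', V, g, by omega, h⟩

theorem AliceSim.comp {f : X → Y → Bool → Matrix m m ℂ → ℝ} {s T : ℕ} (h : AliceSim f s T)
    (K : X → Matrix m n ℂ) (hK : ∀ x, (K x)ᴴ * K x = 1) :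
    AliceSim (fun x y z ρ => f x y z (sandwich (K x) ρ)) s T := by
  obtain ⟨M, U, c, hM, hU, hc, hT, h⟩ := h
  refine ⟨M, fun x => U x * K x, c, hM, fun x => isometry_mul (hU x) (hK x), hc, hT, ?_⟩
  intro x y z ρ
  beta_reduce
  rw [h, sandwich_sandwich]

theorem BobSim.comp {f : X → Y → Bool → Matrix m m ℂ → ℝ} {s T : ℕ} (h : BobSim f s T)
    (K : Y → Matrix m n ℂ) (hK : ∀ y, (K y)ᴴ * K y = 1) :
    BobSim (fun x y z ρ => f x y z (sandwich (K y) ρ)) s T := by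
  obtain ⟨E, h⟩ | ⟨N, T', V, g, hN, hV, hT, hg, h⟩ := h
  · refine Or.inl ⟨fun y => (E y).comp (fun _ : Unit => K y) (by simpa using hK y), ?_⟩
    intro x y z ρ
    beta_reduce
    rw [h, trace_mul_sandwich]
    simp [Measurement.comp]
  · refine Or.inr ⟨N, T', fun y => V y * K y, g, hN, fun y => isometry_mul (hV y) (hK y), hT, hg, ?_⟩
    intro x y z ρ
    beta_reduce
    rw [h, sandwich_sandwich]

theorem card_joint (N : ℕ) : Fintype.card (Joint 1 N 1) = 2 ^ N := by simp

/-- Alice may send her register to Bob. -/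
theorem BobSim.transfer {f : X → Y → Bool → Matrix n n ℂ → ℝ} {s T : ℕ} (h : BobSim f s T)
    (hn : Fintype.card n ≤ 2 ^ (2 * s)) : AliceSim f s (2 * s + T) := by
  obtain ⟨E, h⟩ | ⟨N, T', V, g, hN, hV, rfl, ⟨M, U, c, hM, hU, hc, rfl, hg⟩, h⟩ := h
  -- A measurement costs nothing for any `T`, so all of `T` goes into padding this final message;
  -- this is how an exact total is reached.
  · obtain ⟨J, hJ⟩ := exists_isometry (m := Joint 1 (2 * s + T) 1) (n := n)
      (by rw [card_joint]; exact hn.trans (Nat.pow_le_pow_right (by norm_num) (by omega)))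
    choose E' hE' using fun y => exists_onBob_effect_eq ((E y).pushforward J hJ)
    refine ⟨2 * s + T, fun _ => J, .measure E', by omega, fun _ => hJ, trivial, rfl, ?_⟩
    intro x y z ρ
    rw [h, Continuation.outputProb, hE', trace_mul_sandwich, Measurement.pushforward_effect]
  · obtain ⟨J, hJ⟩ := exists_isometry (m := Joint 1 (2 * s) 1) (n := n) (by rwa [card_joint])
    -- `V y` only prescribes Bob's action on the range of `J`; it extends to the full message
    -- register because his reply has at least `2 * s` qubits.
    choose A hA hAJ using fun y => exists_isometry_mul_eq J hJ (V y) (hV y)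
      (by rw [card_joint, card_joint]; exact Nat.pow_le_pow_right (by norm_num) hN)
    choose A' hA' using fun y => exists_onBob_eq (A y) (hA y)
    choose U' hU' using fun x => exists_onAlice_eq (U x) (hU x)
    refine ⟨2 * s, fun _ => J, .round A' U' c, le_rfl, fun _ => hJ, ⟨rfl, rfl, hc⟩, ?_, ?_⟩
    · simp only [Continuation.cost]; omega
    · intro x y z ρ
      rw [h, hg, Continuation.outputProb, hA', hU']
      change _ = c.outputProb x y z (sandwich (U x * A y) (sandwich J ρ))
      rw [sandwich_sandwich, sandwich_sandwich, Matrix.mul_assoc, hAJ]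

/-- Bob may send his register to Alice. -/
theorem AliceSim.transfer {f : X → Y → Bool → Matrix n n ℂ → ℝ} {s T : ℕ} (h : AliceSim f s T)
    (hn : Fintype.card n ≤ 2 ^ (2 * s)) : BobSim f s (2 * s + T) := by
  obtain ⟨M, U, c, hM, hU, hc, rfl, h⟩ := h
  obtain ⟨J, hJ⟩ := exists_isometry (m := Joint 1 (2 * s) 1) (n := n) (by rwa [card_joint])
  choose A hA hAJ using fun x => exists_isometry_mul_eq J hJ (U x) (hU x)
    (by rw [card_joint, card_joint]; exact Nat.pow_le_pow_right (by norm_num) hM)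
  refine Or.inr ⟨2 * s, M + c.cost, fun _ => J, fun x y z ρ => c.outputProb x y z (sandwich (A x) ρ),
    le_rfl, fun _ => hJ, rfl, ⟨M, A, c, by omega, hA, hc, rfl, fun _ _ _ _ => rfl⟩, ?_⟩
  intro x y z ρ
  beta_reduce
  rw [h, sandwich_sandwich, hAJ]

/-- The output probabilities `F` on joint states of Alice and Bob can be realized by memoryless
protocols whichever party holds the joint state, when it arises from a state of local dimensions at
most `2 ^ s` by local operations. Here `k` is the number of qubits still to be sent in the protocol
that is simulated. -/
def Simulable {a b : Type} (F : X → Y → Bool → Matrix (a × b) (a × b) ℂ → ℝ) (k : ℕ)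
    [Fintype a] [Fintype b] : Prop :=
  ∀ (α β εA εB : Type) [Fintype α] [DecidableEq α] [Fintype β] [DecidableEq β] [Fintype εA]
    [DecidableEq εA] [Fintype εB] [DecidableEq εB] (WA : X → εA → Matrix a α ℂ)
    (WB : Y → εB → Matrix b β ℂ) (s T : ℕ), Fintype.card α ≤ 2 ^ s → Fintype.card β ≤ 2 ^ s →
    (k + 1) * (2 * s + k) ≤ T → (∀ x, ∑ e, (WA x e)ᴴ * WA x e = 1) →
    (∀ y, ∑ e, (WB y e)ᴴ * WB y e = 1) →
    AliceSim (fun x y z ρ => F x y z (∑ e, ∑ e', sandwich (WA x e ⊗ₖ WB y e') ρ)) s T ∧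
    BobSim (fun x y z ρ => F x y z (∑ e, ∑ e', sandwich (WA x e ⊗ₖ WB y e') ρ)) s T

theorem card_prod_le {α β : Type} [Fintype α] [Fintype β] {s : ℕ} (hα : Fintype.card α ≤ 2 ^ s)
    (hβ : Fintype.card β ≤ 2 ^ s) : Fintype.card (α × β) ≤ 2 ^ (2 * s) := by
  rw [Fintype.card_prod, two_mul, pow_add]
  exact Nat.mul_le_mul hα hβ

/-- Under the trace, Alice's Kraus operators collapse to the identity and Bob's turn his measurement
into another one. Bob therefore needs no communication, and Alice needs a single transfer. -/
theorem simulable_measure {a b : Type} [Fintype a] [DecidableEq a] [Fintype b] [DecidableEq b]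
    (E : Y → Measurement b) :
    Simulable (fun (_ : X) y z (ρ : Matrix (a × b) (a × b) ℂ) =>
      (((1 : Matrix a a ℂ) ⊗ₖ (E y).effect z) * ρ).trace.re) 0 := by
  intro α β εA εB _ _ _ _ _ _ _ _ WA WB s T hα hβ hT hWA hWB
  have hB : ∀ T, BobSim (fun x y z ρ => (((1 : Matrix a a ℂ) ⊗ₖ (E y).effect z) *
      ∑ e, ∑ e', sandwich (WA x e ⊗ₖ WB y e') ρ).trace.re) s T := by
    intro T
    refine Or.inl ⟨fun y => ((E y).comp (WB y) (hWB y)).tensorLeft α, ?_⟩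
    intro x y z ρ
    simp only [Matrix.mul_sum, trace_sum, trace_mul_sandwich, conjTranspose_kronecker,
      ← mul_kronecker_mul, Matrix.mul_one]
    simp only [← trace_sum, ← Matrix.sum_mul, ← sum_kronecker_sum, hWA]
    rfl
  refine ⟨?_, hB T⟩
  obtain ⟨t, rfl⟩ : ∃ t, T = 2 * s + t := ⟨T - 2 * s, by omega⟩
  exact (hB t).transfer (card_prod_le hα hβ)

end Simulation

/-! ### Kraus families, and commuting them past a message. -/

/-- Kraus operators followed by an isometry. -/
theorem kraus_isometry_mul {m n k ε : Type*} [Fintype m] [Fintype n] [DecidableEq n]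
    [DecidableEq k] [Fintype ε] {V : Matrix m n ℂ} (hV : Vᴴ * V = 1) {W : ε → Matrix n k ℂ}
    (hW : ∑ e, (W e)ᴴ * W e = 1) : ∑ e, (V * W e)ᴴ * (V * W e) = 1 := by
  rw [← hW]
  refine Finset.sum_congr rfl fun e _ => ?_
  rw [conjTranspose_mul, Matrix.mul_assoc, ← Matrix.mul_assoc _ V, hV, Matrix.one_mul]

theorem kraus_submatrix {m m' k ε : Type*} [Fintype m] [Fintype m'] [DecidableEq k] [Fintype ε]
    {W : ε → Matrix m k ℂ} (hW : ∑ e, (W e)ᴴ * W e = 1) (σ : m' ≃ m) :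
    ∑ e, ((W e).submatrix σ id)ᴴ * (W e).submatrix σ id = 1 := by
  rw [← hW]
  refine Finset.sum_congr rfl fun e _ => ?_
  rw [conjTranspose_submatrix, submatrix_mul_equiv, submatrix_id_id]

theorem kraus_kronecker_one {m k κ ε : Type*} [Fintype m] [Fintype κ] [DecidableEq κ]
    [DecidableEq k] [Fintype ε] {W : ε → Matrix m k ℂ} (hW : ∑ e, (W e)ᴴ * W e = 1) :
    ∑ e, (W e ⊗ₖ (1 : Matrix κ κ ℂ))ᴴ * (W e ⊗ₖ (1 : Matrix κ κ ℂ)) = 1 := by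
  rw [← one_kronecker_one, ← hW]
  simp only [conjTranspose_kronecker, ← mul_kronecker_mul, conjTranspose_one, Matrix.one_mul]
  ext
  simp [Matrix.sum_apply, Finset.sum_mul]

theorem kraus_one_kronecker {m k κ ε : Type*} [Fintype m] [Fintype κ] [DecidableEq κ]
    [DecidableEq k] [Fintype ε] {W : ε → Matrix m k ℂ} (hW : ∑ e, (W e)ᴴ * W e = 1) :
    ∑ e, ((1 : Matrix κ κ ℂ) ⊗ₖ W e)ᴴ * ((1 : Matrix κ κ ℂ) ⊗ₖ W e) = 1 := by
  rw [← one_kronecker_one, ← hW]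
  simp only [conjTranspose_kronecker, ← mul_kronecker_mul, conjTranspose_one, Matrix.one_mul]
  ext
  simp [Matrix.sum_apply, Finset.mul_sum]

/-- Adjoining a one-dimensional register. -/
def adjoinUnique (κ β : Type*) [Unique κ] [DecidableEq β] : Matrix (κ × β) β ℂ :=
  (1 : Matrix β β ℂ).submatrix (Equiv.uniqueProd β κ) (Equiv.refl β)

theorem adjoinUnique_isometry (κ β : Type*) [Unique κ] [Fintype κ] [Fintype β] [DecidableEq β] :
    (adjoinUnique κ β)ᴴ * adjoinUnique κ β = 1 :=
  isometry_submatrix (by simp) _ _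

/-- An empty message needs no compression: the whole operation goes into the postponed Kraus
operators. What remains to be performed does not depend on any input, so either party can do it. -/
theorem exists_eq_mul_adjoinUnique {κ b β ε : Type*} [Unique κ] [Fintype κ] [DecidableEq κ]
    [Fintype b] [Fintype β] [DecidableEq β] [Fintype ε]
    (A : ε → Matrix (κ × b) β ℂ) (hA : ∑ e, (A e)ᴴ * A e = 1) :
    ∃ W : ε → Matrix b β ℂ, ∑ e, (W e)ᴴ * W e = 1 ∧
      ∀ e, A e = ((1 : Matrix κ κ ℂ) ⊗ₖ W e) * adjoinUnique κ β := by
  refine ⟨fun e => (A e).submatrix (Equiv.uniqueProd b κ).symm id, kraus_submatrix hA _, ?_⟩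
  intro e
  ext ⟨k, i⟩ j
  obtain rfl := Unique.eq_default k
  simp [adjoinUnique, Matrix.mul_apply, Fintype.sum_prod_type, Matrix.one_apply]

theorem eq_kronecker_one_mul_of_swap {κ b β γ : Type*} [Fintype κ] [DecidableEq κ] [Fintype γ]
    {A : Matrix (b × κ) β ℂ} {W : Matrix b γ ℂ} {V : Matrix (κ × γ) β ℂ}
    (h : A.submatrix (Equiv.prodComm κ b) id = ((1 : Matrix κ κ ℂ) ⊗ₖ W) * V) :
    A = (W ⊗ₖ (1 : Matrix κ κ ℂ)) * V.submatrix (Equiv.prodComm γ κ) (Equiv.refl β) := by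
  ext ⟨i, k⟩ j
  have h' := congrFun (congrFun h (k, i)) j
  simpa [Matrix.mul_apply, Fintype.sum_prod_type, Matrix.one_apply] using h'

/-- Bob's operation `V`, after which Alice holds the register `κ`. -/
def sendBob (a : Type*) {κ b b₀ : Type*} [DecidableEq a] (V : Matrix (κ × b) b₀ ℂ) :
    Matrix ((a × κ) × b) (a × b₀) ℂ :=
  ((1 : Matrix a a ℂ) ⊗ₖ V).submatrix (Equiv.prodAssoc a κ b) (Equiv.refl _)

/-- Alice's operation `U`, after which Bob holds the register `κ`. -/
def sendAlice (b : Type*) {κ a a₀ : Type*} [DecidableEq b] (U : Matrix (a × κ) a₀ ℂ) :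
    Matrix (a × (κ × b)) (a₀ × b) ℂ :=
  (U ⊗ₖ (1 : Matrix b b ℂ)).submatrix (Equiv.prodAssoc a κ b).symm (Equiv.refl _)

theorem sendBob_isometry (a : Type*) {κ b b₀ : Type*} [Fintype a] [DecidableEq a] [Fintype κ]
    [Fintype b] [Fintype b₀] [DecidableEq b₀] {V : Matrix (κ × b) b₀ ℂ} (hV : Vᴴ * V = 1) :
    (sendBob a V)ᴴ * sendBob a V = 1 :=
  isometry_submatrix (isometry_kronecker (by simp) hV) _ _

theorem sendAlice_isometry (b : Type*) {κ a a₀ : Type*} [Fintype b] [DecidableEq b] [Fintype κ]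
    [Fintype a] [Fintype a₀] [DecidableEq a₀] {U : Matrix (a × κ) a₀ ℂ} (hU : Uᴴ * U = 1) :
    (sendAlice b U)ᴴ * sendAlice b U = 1 :=
  isometry_submatrix (isometry_kronecker hU (by simp)) _ _

/-- This carries the postponed Kraus operators past Bob's message: the sent register joins Alice's
share, on which her operators are extended by the identity. -/
theorem sendBob_mul_kronecker {a α κ b b₀ β β' : Type*} [Fintype a] [DecidableEq a] [Fintype α]
    [DecidableEq α] [Fintype κ] [DecidableEq κ] [Fintype b₀] [Fintype β] [Fintype β']
    {V : Matrix (κ × b) b₀ ℂ} {A : Matrix a α ℂ} {B : Matrix b₀ β ℂ} {B' : Matrix b β' ℂ}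
    {V' : Matrix (κ × β') β ℂ} (h : V * B = ((1 : Matrix κ κ ℂ) ⊗ₖ B') * V') :
    sendBob a V * (A ⊗ₖ B) = ((A ⊗ₖ (1 : Matrix κ κ ℂ)) ⊗ₖ B') * sendBob α V' := by
  have h₁ : sendBob a V * (A ⊗ₖ B) = (A ⊗ₖ (V * B)).submatrix (Equiv.prodAssoc a κ b) id := by
    rw [← Matrix.one_mul A, mul_kronecker_mul, Matrix.one_mul]
    rfl
  have h₂ : (A ⊗ₖ (1 : Matrix κ κ ℂ)) ⊗ₖ B' = (A ⊗ₖ ((1 : Matrix κ κ ℂ) ⊗ₖ B')).submatrix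
      (Equiv.prodAssoc a κ b) (Equiv.prodAssoc α κ β') := by
    ext
    simp [mul_assoc]
  rw [h₁, h, ← Matrix.mul_one A, mul_kronecker_mul, Matrix.mul_one, h₂, sendBob,
    submatrix_mul_equiv]
  rfl

theorem sendAlice_mul_kronecker {b β κ a a₀ α α' : Type*} [Fintype b] [DecidableEq b] [Fintype β]
    [DecidableEq β] [Fintype κ] [DecidableEq κ] [Fintype a₀] [Fintype α] [Fintype α']
    {U : Matrix (a × κ) a₀ ℂ} {B : Matrix b β ℂ} {A : Matrix a₀ α ℂ} {A' : Matrix a α' ℂ}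
    {U' : Matrix (α' × κ) α ℂ} (h : U * A = (A' ⊗ₖ (1 : Matrix κ κ ℂ)) * U') :
    sendAlice b U * (A ⊗ₖ B) = (A' ⊗ₖ ((1 : Matrix κ κ ℂ) ⊗ₖ B)) * sendAlice β U' := by
  have h₁ : sendAlice b U * (A ⊗ₖ B) =
      ((U * A) ⊗ₖ B).submatrix (Equiv.prodAssoc a κ b).symm id := by
    rw [← Matrix.one_mul B, mul_kronecker_mul, Matrix.one_mul]
    rfl
  have h₂ : A' ⊗ₖ ((1 : Matrix κ κ ℂ) ⊗ₖ B) = ((A' ⊗ₖ (1 : Matrix κ κ ℂ)) ⊗ₖ B).submatrix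
      (Equiv.prodAssoc a κ b).symm (Equiv.prodAssoc α' κ β).symm := by
    ext
    simp [mul_assoc]
  rw [h₁, h, ← Matrix.mul_one B, mul_kronecker_mul, Matrix.mul_one, h₂, sendAlice,
    submatrix_mul_equiv]
  rfl

/-! ### The induction over rounds. -/

section Simulation

variable {X Y : Type*}

/-- The difference of the two budgets is `(q - 1) * (2 * s + q)`: equality for single-qubit
messages, failure in general for `q = 0`, where no transfer can be afforded. -/
theorem transfer_budget {s k q T : ℕ} (hq : q ≠ 0) (h : (k + q + 1) * (2 * s + (k + q)) ≤ T) :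
    2 * s + (k + 1) * (2 * (s + q) + k) ≤ T := by
  obtain ⟨r, rfl⟩ := Nat.exists_eq_succ_of_ne_zero hq
  refine le_trans ?_ h
  simp only [Nat.succ_eq_add_one]
  nlinarith [Nat.zero_le (r * s), Nat.zero_le (r * r)]

theorem send_budget {s k q T : ℕ} (h : (k + q + 1) * (2 * s + (k + q)) ≤ T) :
    (k + 1) * (2 * (s + q) + k) ≤ T := by
  obtain rfl | hq := eq_or_ne q 0
  · simpa using h
  · exact (Nat.le_add_left _ _).trans (transfer_budget hq h)

theorem card_prod_qubits_le {α : Type} [Fintype α] {s : ℕ} (hα : Fintype.card α ≤ 2 ^ s) (q : ℕ) :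
    Fintype.card (α × Qubits q) ≤ 2 ^ (s + q) := by
  rw [Fintype.card_prod, pow_add]
  exact Nat.mul_le_mul hα (by simp)

/-- A protocol that goes on with a message of Bob. -/
theorem Simulable.sendBob {a b b₀ : Type} [Fintype a] [DecidableEq a] [Fintype b] [DecidableEq b]
    [Fintype b₀] [DecidableEq b₀] {q k : ℕ}
    {F : X → Y → Bool → Matrix ((a × Qubits q) × b) ((a × Qubits q) × b) ℂ → ℝ}
    (hF : Simulable F k) (V : Y → Matrix (Qubits q × b) b₀ ℂ) (hV : ∀ y, (V y)ᴴ * V y = 1) :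
    Simulable (fun x y z ρ => F x y z (sandwich (QComm.sendBob a (V y)) ρ)) (k + q) := by
  intro α β εA εB _ _ _ _ _ _ _ _ WA WB s T hα hβ hT hWA hWB
  have hB : ∀ T, (k + 1) * (2 * (s + q) + k) ≤ T → BobSim (fun x y z ρ => F x y z
      (sandwich (QComm.sendBob a (V y)) (∑ e, ∑ e', sandwich (WA x e ⊗ₖ WB y e') ρ))) s T := by
    -- If Bob holds the joint state, he performs the compressed isometry himself and no transfer is
    -- needed.
    intro T hT
    choose V' W' hV' hW' hVW using fun y =>
      exists_compression (fun e => V y * WB y e) (kraus_isometry_mul (hV y) (hWB y))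
    have h := (hF _ _ _ _ (fun x e => WA x e ⊗ₖ (1 : Matrix (Qubits q) (Qubits q) ℂ)) W' (s + q) T
      (card_prod_qubits_le hα q) ?_ hT (fun x => kraus_kronecker_one (hWA x)) hW').2
    · have h' := (h.comp (fun y => QComm.sendBob α (V' y))
        (fun y => sendBob_isometry α (hV' y))).mono (Nat.le_add_right s q)
      simpa only [sandwich_sum, sandwich_sandwich, sendBob_mul_kronecker (hVW _ _)] using h'
    · rw [Fintype.card_fin]
      refine (min_le_right _ _).trans ?_
      rw [Fintype.card_prod, mul_comm, ← Fintype.card_prod]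
      exact card_prod_qubits_le hβ q
  refine ⟨?_, hB T (send_budget hT)⟩
  -- If Alice holds the state, a nonempty message pays for transferring it to Bob. An empty one
  -- leaves the budget unchanged, so ownership must not change.
  obtain rfl | hq := eq_or_ne q 0
  · choose W' hW' hVW using fun y =>
      exists_eq_mul_adjoinUnique (fun e => V y * WB y e) (kraus_isometry_mul (hV y) (hWB y))
    have h := (hF _ _ _ _ (fun x e => WA x e ⊗ₖ (1 : Matrix (Qubits 0) (Qubits 0) ℂ)) W' s T
      (card_prod_qubits_le hα 0) hβ (by simpa using hT) (fun x => kraus_kronecker_one (hWA x))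
      hW').1
    have h' := h.comp (fun _ => QComm.sendBob α (adjoinUnique (Qubits 0) β))
      (fun _ => sendBob_isometry α (adjoinUnique_isometry _ _))
    simpa only [sandwich_sum, sandwich_sandwich, sendBob_mul_kronecker (hVW _ _)] using h'
  · have h := transfer_budget hq hT
    obtain ⟨t, rfl⟩ : ∃ t, T = 2 * s + t := ⟨T - 2 * s, by omega⟩
    exact (hB t (by omega)).transfer (card_prod_le hα hβ)

/-- A protocol that goes on with a message of Alice. -/
theorem Simulable.sendAlice {b a a₀ : Type} [Fintype b] [DecidableEq b] [Fintype a] [DecidableEq a]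
    [Fintype a₀] [DecidableEq a₀] {q k : ℕ}
    {F : X → Y → Bool → Matrix (a × (Qubits q × b)) (a × (Qubits q × b)) ℂ → ℝ}
    (hF : Simulable F k) (U : X → Matrix (a × Qubits q) a₀ ℂ) (hU : ∀ x, (U x)ᴴ * U x = 1) :
    Simulable (fun x y z ρ => F x y z (sandwich (QComm.sendAlice b (U x)) ρ)) (k + q) := by
  intro α β εA εB _ _ _ _ _ _ _ _ WA WB s T hα hβ hT hWA hWB
  have hβ' : Fintype.card (Qubits q × β) ≤ 2 ^ (s + q) := by
    rw [Fintype.card_prod, mul_comm, ← Fintype.card_prod]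
    exact card_prod_qubits_le hβ q
  have hA : ∀ T, (k + 1) * (2 * (s + q) + k) ≤ T → AliceSim (fun x y z ρ => F x y z
      (sandwich (QComm.sendAlice b (U x)) (∑ e, ∑ e', sandwich (WA x e ⊗ₖ WB y e') ρ))) s T := by
    intro T hT
    -- Compression expects the sent register in the first factor, whereas Alice's message is the
    -- second; hence the swap.
    choose U' W' hU' hW' hUW using fun x => exists_compression
      (fun e => (U x * WA x e).submatrix (Equiv.prodComm (Qubits q) a) id)
      (kraus_submatrix (kraus_isometry_mul (hU x) (hWA x)) _)
    have h := (hF _ _ _ _ W' (fun y e => (1 : Matrix (Qubits q) (Qubits q) ℂ) ⊗ₖ WB y e) (s + q) T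
      ?_ hβ' hT hW' (fun y => kraus_one_kronecker (hWB y))).1
    · have h' := (h.comp (fun x => QComm.sendAlice β ((U' x).submatrix (Equiv.prodComm _ _)
        (Equiv.refl α))) (fun x => sendAlice_isometry β (isometry_submatrix (hU' x) _ _))).mono
        (Nat.le_add_right s q)
      simpa only [sandwich_sum, sandwich_sandwich,
        sendAlice_mul_kronecker (eq_kronecker_one_mul_of_swap (hUW _ _))] using h'
    · rw [Fintype.card_fin]
      refine (min_le_right _ _).trans ?_
      rw [Fintype.card_prod, mul_comm, ← Fintype.card_prod]
      exact card_prod_qubits_le hα q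
  refine ⟨hA T (send_budget hT), ?_⟩
  obtain rfl | hq := eq_or_ne q 0
  · choose W' hW' hUW using fun x => exists_eq_mul_adjoinUnique
      (fun e => (U x * WA x e).submatrix (Equiv.prodComm (Qubits 0) a) id)
      (kraus_submatrix (kraus_isometry_mul (hU x) (hWA x)) _)
    have h := (hF _ _ _ _ W' (fun y e => (1 : Matrix (Qubits 0) (Qubits 0) ℂ) ⊗ₖ WB y e) s T
      hα hβ' (by simpa using hT) hW' (fun y => kraus_one_kronecker (hWB y))).2
    have h' := h.comp (fun _ => QComm.sendAlice β ((adjoinUnique (Qubits 0) α).submatrix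
      (Equiv.prodComm _ _) (Equiv.refl α)))
      (fun _ => sendAlice_isometry β (isometry_submatrix (adjoinUnique_isometry _ _) _ _))
    simpa only [sandwich_sum, sandwich_sandwich,
      sendAlice_mul_kronecker (eq_kronecker_one_mul_of_swap (hUW _ _))] using h'
  · have h := transfer_budget hq hT
    obtain ⟨t, rfl⟩ : ∃ t, T = 2 * s + t := ⟨T - 2 * s, by omega⟩
    exact (hA t (by omega)).transfer (card_prod_le hα hβ)

theorem onAlice_mul_onBob {a q b q' b' a' q'' : ℕ}
    (U : Matrix (Fin a' × Qubits q'') (Fin a × Qubits q') ℂ)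
    (V : Matrix (Qubits q' × Fin b') (Qubits q × Fin b) ℂ) :
    onAlice b' U * onBob a V = sendAlice (Fin b') U * sendBob (Fin a) V := by
  have h : onAlice b' U = (sendAlice (Fin b') U).submatrix id
      (Equiv.prodAssoc (Fin a) (Qubits q') (Fin b')).symm := rfl
  have h' : onBob a V = (sendBob (Fin a) V).submatrix
      (Equiv.prodAssoc (Fin a) (Qubits q') (Fin b')).symm id := rfl
  rw [h, h', submatrix_mul_equiv, submatrix_id_id]

theorem Continuation.simulable {a q b : ℕ} (c : Continuation X Y a q b) :
    Simulable (a := Fin a) (b := Qubits q × Fin b) (fun x y z ρ => c.outputProb x y z ρ) c.cost := by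
  induction c with
  | measure E => exact simulable_measure E
  | @round a q b q' b' a' q'' V U rest ih =>
    have h := (ih.sendAlice (fun x => (U x).mat) (fun x => (U x).isometry)).sendBob
      (fun y => (V y).mat) (fun y => (V y).isometry)
    have hc : (Continuation.round V U rest).cost = rest.cost + q'' + q' := by
      simp only [Continuation.cost]; omega
    rw [hc]
    simp only [sandwich_sandwich, ← onAlice_mul_onBob] at h
    exact h

/-! ### Initial states and assembling the protocol. -/

open scoped MatrixOrder Matrix.Norms.L2Operator in
/-- A mixed state is a mixture of pure states. -/
theorem DensityMatrix.exists_kraus {n : Type} [Fintype n] [DecidableEq n] (ρ : DensityMatrix n) :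
    ∃ W : n → Matrix n (Fin 1) ℂ, ∑ e, (W e)ᴴ * W e = 1 ∧ ∑ e, W e * (W e)ᴴ = ρ.mat := by
  obtain ⟨B, hB⟩ := (CStarAlgebra.nonneg_iff_eq_star_mul_self (a := ρ.mat)).1 ρ.posSemidef.nonneg
  refine ⟨fun e => Matrix.of fun i _ => Bᴴ i e, ?_, ?_⟩
  · ext i j
    have h := ρ.trace_eq_one
    rw [hB, star_eq_conjTranspose, Matrix.trace] at h
    simp only [Matrix.diag_apply, Matrix.mul_apply] at h
    rw [Subsingleton.elim i j, Matrix.one_apply_eq, ← h, Finset.sum_comm]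
    simp [Matrix.sum_apply, Matrix.mul_apply, mul_comm]
  · rw [hB]
    ext i j
    simp [Matrix.sum_apply, Matrix.mul_apply, star_eq_conjTranspose]

theorem Protocol.firstState_eq (P : Protocol X Y) (x : X) :
    P.firstState x =
      sandwich (sendAlice (Fin P.b₀) (P.U₁ x).mat) (P.ρA.mat ⊗ₖ P.ρB.mat) := by
  have h : sandwich ((P.U₁ x).mat ⊗ₖ (1 : Matrix (Fin P.b₀) (Fin P.b₀) ℂ))
      (P.ρA.mat ⊗ₖ P.ρB.mat) = ((P.U₁ x).mat * P.ρA.mat * (P.U₁ x).matᴴ) ⊗ₖ P.ρB.mat := by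
    rw [sandwich, conjTranspose_kronecker, ← mul_kronecker_mul, ← mul_kronecker_mul]
    simp
  rw [Protocol.firstState, ← h]
  rfl

/-- The state of a one-dimensional register. -/
def trivialState : DensityMatrix (Fin 1) where
  mat := 1
  posSemidef := PosSemidef.one
  trace_eq_one := by simp

theorem AliceSim.exists_protocol {f : X → Y → Bool → Matrix (Fin 1 × Fin 1) (Fin 1 × Fin 1) ℂ → ℝ}
    {s T : ℕ} (h : AliceSim f s T) :
    ∃ P : Protocol X Y, P.Memoryless ∧ P.cost = T ∧ ∀ x y z, P.outputProb x y z = f x y z 1 := by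
  obtain ⟨M, U, c, -, hU, hc, hT, h⟩ := h
  let e : Fin 1 × Qubits M ≃ Joint 1 M 1 :=
    (Equiv.prodUnique (Fin 1 × Qubits M) (Fin 1)).symm.trans (Equiv.prodAssoc _ _ _)
  refine ⟨⟨1, 1, trivialState, trivialState, M, 1, fun x => ⟨(U x).submatrix e
    (Equiv.uniqueProd (Fin 1) (Fin 1)).symm, isometry_submatrix (hU x) _ _⟩, c⟩,
    ⟨rfl, rfl, rfl, hc⟩, hT, ?_⟩
  intro x y z
  rw [h, Protocol.outputProb, Protocol.firstState_eq]
  congr 1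
  simp only [trivialState, one_kronecker_one]
  congr 1
  ext ⟨i, i', i''⟩ ⟨j, j'⟩
  obtain rfl := Subsingleton.elim i'' j'
  simp [sendAlice, e, Subsingleton.elim i'' 0, Subsingleton.elim j 0]

end Simulation

end QComm

theorem mainTheorem3 {X : Type*} {Y : Type*} (Q : ℕ) (P : QComm.Protocol X Y) (hQ : P.cost = Q) :
    ∃ P' : QComm.Protocol X Y,
      P'.Memoryless ∧ P'.cost = Q ^ 2 + 2 * Q ∧
        ∀ (x : X) (y : Y) (z : Bool), P'.outputProb x y z = P.outputProb x y z := by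
  obtain ⟨WA, hWA, hA⟩ := P.ρA.exists_kraus
  obtain ⟨WB, hWB, hB⟩ := P.ρB.exists_kraus
  have hs := P.rest.simulable.sendAlice (fun x => (P.U₁ x).mat) (fun x => (P.U₁ x).isometry)
  -- With `s = 0` and `k = Q` the invariant asks for only `(Q + 1) * Q` qubits; the remaining `Q`
  -- are padding.
  have h := (hs (Fin 1) (Fin 1) _ _ (fun _ => WA) (fun _ => WB) 0 (Q ^ 2 + 2 * Q) (by simp)
    (by simp) (by rw [add_comm _ P.q₁, show P.q₁ + P.rest.cost = Q from hQ]; nlinarith)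
    (fun _ => hWA) (fun _ => hWB)).1
  obtain ⟨P', hP', hc, hout⟩ := h.exists_protocol
  refine ⟨P', hP', hc, fun x y z => ?_⟩
  rw [hout, QComm.Protocol.outputProb, QComm.Protocol.firstState_eq, ← hA, ← hB]
  simp only [QComm.sandwich, QComm.sum_kronecker_sum, Matrix.mul_one,
    Matrix.conjTranspose_kronecker, Matrix.mul_kronecker_mul]
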